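/- Let $E$ be a finite set of agents and $f:2^E\to\mathbb{R}_{\ge 0}$ the rank function of a polymatroid ($f(\emptyset)=0$, $f$ monotone and submodular). For a set function $h$ put $\mathcal{P}(h)=\{x\in\mathbb{R}_{\ge0}^E : x(A)\le h(A)\ \forall A\subseteq E\}$ and $\mathcal{B}(h)=\{x\in\mathcal{P}(h): x(E)=h(E)\}$. Let $\varepsilon>0$, $K\ge 1$, $V=(1+\varepsilon)^K$. Partition $[1,V]$ into the buckets $I_k=[(1+\varepsilon)^{k-1},(1+\varepsilon)^{k})$, $1\le k\le K$, the last one also containing $V$, and let bucket $I_k$ have a canonical value $m_k$, where $0<m_1<\dots<m_K$ (for instance $m_k\in I_k$). The values $v_i$ of the agents are independent, $v_i\sim D_i$, where $D_i$ is a probability measure supported on $[1,V]$. A mapping rule consists, for each agent $i$, of a signal space and a Markov kernel from values to signals; given the values, the signals $\sigma_i$ are drawn independently. The posterior mean $\mu_i$ is the mean of the conditional law of $v_i$ given $\sigma_i$. Given posterior means $\mu$, let $\mathcal{X}(\mu)$ be the set of $x\in\mathcal{P}(f)$ that maximize $\sum_i\mu_i'x_i$, where $\mu'_i=m_j$ if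 $\mu_i\in I_j$. A selection rule is a measurable map that assigns to every signal profile (almost surely) an allocation $x\in\mathcal{X}(\mu)$. The fake utility of agent $i$ for bucket $k$ is $\hat U_{i,k}=m_kx_i$ if $\mu_i\in I_k$, and $0$ otherwise. For $S\subseteq E$ let $\hat g_k(S;\mu)=\sup_{x\in\mathcal{X}(\mu)}\sum_{i\in S}\hat U_{i,k}$. Fix mapping rules $\Delta=(\Delta_1,\dots,\Delta_K)$. Let $\mathcal{U}$ be the set of all vectors $(\hat U_i)_{i\in E}$, $\hat U_i=\frac1K\sum_{k=1}^K\mathbb{E}_{\mu\sim\Delta_k}[\hat U_{i,k}]$, obtained by varying the selection rules used for $\Delta_1,\dots,\Delta_K$. Let $\rho(S)=\frac1K\sum_{k=1}^K\mathbb{E}_{\mu\sim\Delta_k}[\hat g_k(S;\mu)]$ and $$\hat{\mathcal{R}}(\Delta)=\mathcal{P}(\rho)=\Big\{y\ge0:\ \sum_{i\in S}y_i\le\rho(S)\ \ \forall S\subseteq E\Big\}.$$ Then: 1. For every $k$ and every $\mu\in[1,V]^E$, the supremum defining $\hat g_k(S;\mu)$ is attained, and $\hat g_k(S;\mu)=m_k\big(f(P_{>k}\cup(S\cap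 E'_k))-f(P_{>k})\big)$, where $E'_k=\{i:\mu_i\in I_k\}$ and $P_{>k}=\bigcup_{j>k}E'_j$. The function $\hat g_k(\cdot;\mu)$ is nonnegative, monotone and submodular, and vanishes on $\emptyset$. 2. Under each $\Delta_k$ the posterior means lie in $[1,V]$ almost surely, and all the expectations above are expectations of integrable random variables. 3. $\rho$ is nonnegative, monotone and submodular with $\rho(\emptyset)=0$, so $\hat{\mathcal{R}}(\Delta)$ is a polymatroid, and $$\mathcal{B}(\rho)\subseteq\mathcal{U}\subseteq\hat{\mathcal{R}}(\Delta).$$ -/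

import Mathlib

open MeasureTheory ProbabilityTheory

universe u v

namespace Persuasion

/-- `f` is the rank function of a polymatroid on the finite ground set `E`. -/
structure IsPolymatroidRank {E : Type u} [DecidableEq E] (f : Finset E → ℝ) : Prop where
  nonneg : ∀ A, 0 ≤ f A
  empty : f ∅ = 0
  mono : ∀ A B, A ⊆ B → f A ≤ f B
  submodular : ∀ A B, f (A ∪ B) + f (A ∩ B) ≤ f A + f B

/-- The independence polytope of `f`, a subset of the nonnegative orthant. -/
def independencePolytope {E : Type u} (f : Finset E → ℝ) : Set (E → ℝ) :=
  {x | (∀ i, 0 ≤ x i) ∧ ∀ A : Finset E, ∑ i ∈ A, x i ≤ f A}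

/-- The base polytope of `f`. -/
def basePolytope {E : Type u} [Fintype E] (f : Finset E → ℝ) : Set (E → ℝ) :=
  {x | x ∈ independencePolytope f ∧ ∑ i, x i = f Finset.univ}

/-- The face of allocations in the independence polytope of `f` that maximize the welfare
`∑ i, w i * x i`. -/
def optimalFace {E : Type u} [Fintype E] (f : Finset E → ℝ) (w : E → ℝ) : Set (E → ℝ) :=
  {x | x ∈ independencePolytope f ∧
    ∀ y ∈ independencePolytope f, ∑ i, w i * y i ≤ ∑ i, w i * x i}

/-- The buckets of `[1, V]` for `V = (1 + ε) ^ K`, indexed from `0`: bucket `k` is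
`[(1 + ε) ^ k, (1 + ε) ^ (k + 1))`, and the last one also contains its right end point `V`,
so that the buckets partition `[1, V]`. -/
def bucket (ε V : ℝ) {K : ℕ} (k : Fin K) : Set ℝ :=
  {t | (1 + ε) ^ (k : ℕ) ≤ t ∧
    (t < (1 + ε) ^ ((k : ℕ) + 1) ∨ ((k : ℕ) + 1 = K ∧ t = V))}

/-- The canonical value of a posterior mean `t`: it is `m k` if `t` lies in bucket `k`
(the buckets are disjoint), and `0` if `t` lies in no bucket, that is outside `[1, V]`. -/
noncomputable def canonicalValue (ε V : ℝ) {K : ℕ} (m : Fin K → ℝ) (t : ℝ) : ℝ :=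
  ∑ k, (bucket ε V k).indicator (fun _ => m k) t

/-- The allocations open to the receiver when the posterior means are `μ`: the welfare-optimal
face for the vector of canonical values. -/
def receiverAllocations {E : Type u} [Fintype E] (f : Finset E → ℝ) (ε V : ℝ) {K : ℕ}
    (m : Fin K → ℝ) (μ : E → ℝ) : Set (E → ℝ) :=
  optimalFace f (fun i => canonicalValue ε V m (μ i))

open Classical in
/-- The fake utility of agent `i` restricted to bucket `k`, at posterior means `μ` and
allocation `x`. -/
noncomputable def fakeUtility {E : Type u} (ε V : ℝ) {K : ℕ} (m : Fin K → ℝ) (k : Fin K)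
    (μ x : E → ℝ) (i : E) : ℝ :=
  if μ i ∈ bucket ε V k then m k * x i else 0

/-- The maximum total fake utility (restricted to bucket `k`) of the agents in `S` at posterior
means `μ`, over all choices of the receiver among welfare-optimal allocations. -/
noncomputable def gHat {E : Type u} [Fintype E] (f : Finset E → ℝ) (ε V : ℝ) {K : ℕ}
    (m : Fin K → ℝ) (k : Fin K) (μ : E → ℝ) (S : Finset E) : ℝ :=
  sSup ((fun x : E → ℝ => ∑ i ∈ S, fakeUtility ε V m k μ x i) ''
    receiverAllocations f ε V m μ)

open Classical in
/-- The agents whose posterior mean lies in bucket `k`. -/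
noncomputable def agentsIn {E : Type u} [Fintype E] (ε V : ℝ) {K : ℕ} (μ : E → ℝ)
    (k : Fin K) : Finset E :=
  Finset.univ.filter (fun i => μ i ∈ bucket ε V k)

open Classical in
/-- The agents whose posterior mean lies in a bucket higher than `k`. -/
noncomputable def agentsAbove {E : Type u} [Fintype E] (ε V : ℝ) {K : ℕ} (μ : E → ℝ)
    (k : Fin K) : Finset E :=
  Finset.univ.filter (fun i => ∃ j : Fin K, k < j ∧ μ i ∈ bucket ε V j)

/-- A mapping rule: for each agent a space of signals, and a Markov kernel sending the value of
the agent to a distribution over the signals of the agent. -/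
structure MappingRule (E : Type u) where
  Signal : E → Type v
  [measurableSpace : ∀ i, MeasurableSpace (Signal i)]
  kernel : ∀ i, Kernel ℝ (Signal i)
  [isMarkovKernel : ∀ i, IsMarkovKernel (kernel i)]

attribute [instance] MappingRule.measurableSpace MappingRule.isMarkovKernel

namespace MappingRule

variable {E : Type u} (Δ : MappingRule.{u, v} E) (D : E → Measure ℝ)

/-- The law of the signal profile: the values are independent with laws `D i`, and each agent's
signal is drawn independently from that agent's kernel at that agent's value. -/
noncomputable def signalLaw [Fintype E] : Measure (∀ i, Δ.Signal i) :=
  Measure.pi (fun i => (D i).bind (Δ.kernel i))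

/-- The vector of posterior means given the signal profile `σ`; `posterior` is the Bayesian
inverse of the kernel with respect to the prior `D i`. -/
noncomputable def posteriorMean [∀ i, IsFiniteMeasure (D i)] (σ : ∀ i, Δ.Signal i) : E → ℝ :=
  fun i => ∫ t, t ∂(posterior (Δ.kernel i) (D i) (σ i))

/-- A selection rule for the receiver: a measurable choice, for every signal profile, of an
allocation that is welfare-optimal for the canonical values of the posterior means. As these
are determined by the signals only almost surely, so is the requirement. -/
def IsSelectionRule [Fintype E] [∀ i, IsFiniteMeasure (D i)] (f : Finset E → ℝ) (ε V : ℝ)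
    {K : ℕ} (m : Fin K → ℝ) (x : (∀ i, Δ.Signal i) → E → ℝ) : Prop :=
  Measurable x ∧
    ∀ᵐ σ ∂(Δ.signalLaw D), x σ ∈ receiverAllocations f ε V m (Δ.posteriorMean D σ)

end MappingRule

section Randomized

variable {E : Type u} [Fintype E] {K : ℕ} (Δ : Fin K → MappingRule.{u, v} E)
  (D : E → Measure ℝ) [∀ i, IsFiniteMeasure (D i)] (f : Finset E → ℝ) (ε V : ℝ) (m : Fin K → ℝ)

/-- The expected fake utility vector of the randomized single-mean policy that picks one of the
`K` buckets uniformly at random and, for bucket `k`, uses the mapping rule `Δ k` and the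
selection rule `x k`. -/
noncomputable def expectedFakeUtility (x : ∀ k, (∀ i, (Δ k).Signal i) → E → ℝ) : E → ℝ :=
  fun i => (1 / (K : ℝ)) * ∑ k,
    ∫ σ, fakeUtility ε V m k ((Δ k).posteriorMean D σ) (x k σ) i ∂((Δ k).signalLaw D)

/-- The expected fake utility vectors obtained from the mapping rule `Δ` by varying the selection
rule of the receiver. -/
def achievableFakeUtilities : Set (E → ℝ) :=
  {u | ∃ x : ∀ k, (∀ i, (Δ k).Signal i) → E → ℝ,
    (∀ k, (Δ k).IsSelectionRule D f ε V m (x k)) ∧ u = expectedFakeUtility Δ D ε V m x}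

/-- The set function `S ↦ (1 / K) ∑ k, 𝔼[gHat k μ S]`, with `μ` the posterior means produced
by `Δ k`. -/
noncomputable def rankHat (S : Finset E) : ℝ :=
  (1 / (K : ℝ)) * ∑ k,
    ∫ σ, gHat f ε V m k ((Δ k).posteriorMean D σ) S ∂((Δ k).signalLaw D)

end Randomized

end Persuasion

/-!
Rank the agents by decreasing canonical value, breaking ties by a fixed ranking `q`. The greedy
vector of this ranking is welfare-optimal, and welfare-optimality forces every allocation to
exhaust `f` on each superlevel set of the canonical values. Hence the fake utilities for bucket `k`
are bounded by `m k` times the rank function of a minor of `f`, namely of the contraction by the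
agents above bucket `k`, restricted to the agents in it. The bound is attained, because on bucket
`k` the greedy vector of `f` is the greedy vector of that minor for the ranking `q`.

Since greedy vectors are linear in the set function, the selection rule that always plays greedily
with ties broken by `q` yields exactly the greedy vector of the averaged rank function for `q`. A
base polytope is the convex hull of its greedy vectors (separate a point from the hull by a
hyperplane and rank the agents by the coefficients), and the achievable vectors form a convex set,
so the whole base polytope is achievable.
-/

namespace Persuasion

section Minor

variable {E : Type u} [DecidableEq E] {f : Finset E → ℝ}

/-- The rank function of the minor of `f` obtained by contracting `T` and then restricting to `L`.
It is defined on all subsets of the ground set, the agents outside `L` being loops. -/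
def minorRank (f : Finset E → ℝ) (T L S : Finset E) : ℝ :=
  f (T ∪ (S ∩ L)) - f T

namespace IsPolymatroidRank

theorem minorRank (hf : IsPolymatroidRank f) (T L : Finset E) :
    IsPolymatroidRank (minorRank f T L) where
  nonneg _ := sub_nonneg.2 (hf.mono _ _ Finset.subset_union_left)
  empty := by simp [Persuasion.minorRank]
  mono _ _ h := sub_le_sub_right
    (hf.mono _ _ (Finset.union_subset_union_right (Finset.inter_subset_inter_right h))) _
  submodular A B := by
    have h := hf.submodular (T ∪ (A ∩ L)) (T ∪ (B ∩ L))
    rw [← Finset.union_union_distrib_left, ← Finset.union_inter_distrib_right,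
      ← Finset.union_inter_distrib_left, ← Finset.inter_inter_distrib_right] at h
    simp only [Persuasion.minorRank]
    linarith

theorem minorRank_le (hf : IsPolymatroidRank f) (T L S : Finset E) :
    Persuasion.minorRank f T L S ≤ f S := by
  rw [Persuasion.minorRank]
  have hsub := hf.submodular T (S ∩ L)
  have hcap := hf.nonneg (T ∩ (S ∩ L))
  have hmono := hf.mono _ _ (Finset.inter_subset_left : S ∩ L ⊆ S)
  linarith

theorem const_mul (hf : IsPolymatroidRank f) {c : ℝ} (hc : 0 ≤ c) :
    IsPolymatroidRank fun S => c * f S where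
  nonneg A := mul_nonneg hc (hf.nonneg A)
  empty := by rw [hf.empty, mul_zero]
  mono A B h := mul_le_mul_of_nonneg_left (hf.mono A B h) hc
  submodular A B := by
    simp only [← mul_add]
    exact mul_le_mul_of_nonneg_left (hf.submodular A B) hc

theorem sum {ι : Type*} {s : Finset ι} {F : ι → Finset E → ℝ}
    (hF : ∀ k ∈ s, IsPolymatroidRank (F k)) : IsPolymatroidRank fun S => ∑ k ∈ s, F k S where
  nonneg A := Finset.sum_nonneg fun k hk => (hF k hk).nonneg A
  empty := Finset.sum_eq_zero fun k hk => (hF k hk).empty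
  mono A B h := Finset.sum_le_sum fun k hk => (hF k hk).mono A B h
  submodular A B := by
    simp only [← Finset.sum_add_distrib]
    exact Finset.sum_le_sum fun k hk => (hF k hk).submodular A B

theorem integral {Ω : Type*} [MeasurableSpace Ω] {P : Measure Ω} {F : Ω → Finset E → ℝ}
    (hF : ∀ᵐ ω ∂P, IsPolymatroidRank (F ω)) (hint : ∀ S, Integrable (fun ω => F ω S) P) :
    IsPolymatroidRank fun S => ∫ ω, F ω S ∂P where
  nonneg A := integral_nonneg_of_ae (hF.mono fun _ h => h.nonneg A)
  empty := integral_eq_zero_of_ae (hF.mono fun _ h => h.empty)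
  mono A B hAB := integral_mono_ae (hint A) (hint B) (hF.mono fun _ h => h.mono A B hAB)
  submodular A B := by
    rw [← integral_add (hint _) (hint _), ← integral_add (hint _) (hint _)]
    exact integral_mono_ae ((hint _).add (hint _)) ((hint _).add (hint _))
      (hF.mono fun _ h => h.submodular A B)

end IsPolymatroidRank

end Minor

section Polytope

variable {E : Type u} {f : Finset E → ℝ}

theorem mem_Icc_of_mem_independencePolytope {x : E → ℝ} (hx : x ∈ independencePolytope f) (i : E) :
    x i ∈ Set.Icc 0 (f {i}) :=
  ⟨hx.1 i, by simpa using hx.2 {i}⟩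

theorem convex_independencePolytope (f : Finset E → ℝ) : Convex ℝ (independencePolytope f) := by
  have h : independencePolytope f = Set.Ici 0 ∩ ⋂ A : Finset E, {x | ∑ i ∈ A, x i ≤ f A} := by
    ext x
    simp [independencePolytope, Pi.le_def]
  rw [h]
  refine (convex_Ici 0).inter (convex_iInter fun A => convex_halfSpace_le ⟨?_, ?_⟩ _)
  · exact fun x y => Finset.sum_add_distrib
  · exact fun c x => (Finset.mul_sum A x c).symm

theorem isExposed_optimalFace [Fintype E] (f : Finset E → ℝ) (w : E → ℝ) :
    IsExposed ℝ (independencePolytope f) (optimalFace f w) := fun _ =>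
  ⟨∑ i, w i • ContinuousLinearMap.proj i, by ext x; simp [optimalFace]⟩

theorem convex_optimalFace [Fintype E] (f : Finset E → ℝ) (w : E → ℝ) :
    Convex ℝ (optimalFace f w) :=
  (isExposed_optimalFace f w).convex (convex_independencePolytope f)

end Polytope

section InitialSegment

variable {E : Type u} [Fintype E] {α : Type*} [LinearOrder α] {r : E → α}

/-- The agents ranked before agent `i` by the ranking `r`. -/
def before (r : E → α) (i : E) : Finset E :=
  {j | r j < r i}

@[simp]
theorem mem_before {i j : E} : j ∈ before r i ↔ r j < r i := by
  simp [before]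

/-- A set of agents is an initial segment of the ranking `r` if it contains with each agent all the
agents ranked before that agent. -/
def IsInitialSegment (r : E → α) (L : Finset E) : Prop :=
  ∀ i ∈ L, before r i ⊆ L

theorem isInitialSegment_univ : IsInitialSegment r Finset.univ :=
  fun _ _ => Finset.subset_univ _

theorem isInitialSegment_before (i : E) : IsInitialSegment r (before r i) := fun _ hj _ hk =>
  mem_before.2 ((mem_before.1 hk).trans (mem_before.1 hj))

theorem subset_before (hr : Function.Injective r) {a : E} {s : Finset E} (ha : a ∉ s)
    (hmax : ∀ i ∈ s, r i ≤ r a) : s ⊆ before r a := fun i hi =>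
  mem_before.2 ((hmax i hi).lt_of_ne fun h => ha (hr h ▸ hi))

theorem IsInitialSegment.eq_before [DecidableEq E] (hr : Function.Injective r) {a : E}
    {s : Finset E} (hL : IsInitialSegment r (insert a s)) (ha : a ∉ s)
    (hmax : ∀ i ∈ s, r i ≤ r a) : s = before r a :=
  (subset_before hr ha hmax).antisymm
    ((Finset.subset_insert_iff_of_notMem (by simp)).1 (hL a (Finset.mem_insert_self a s)))

/-- Abel summation along the ranking `r`. -/
theorem mul_sum_le_sum_mul_of_isInitialSegment (hr : Function.Injective r)
    {w d : E → ℝ} (hw : Antivary w r) (hd : ∀ A, IsInitialSegment r A → 0 ≤ ∑ i ∈ A, d i)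
    {L : Finset E} (hL : IsInitialSegment r L) {c : ℝ} (hc : ∀ i ∈ L, c ≤ w i) :
    c * ∑ i ∈ L, d i ≤ ∑ i ∈ L, w i * d i := by
  classical
  induction L using Finset.induction_on_max_value r generalizing c with
  | empty => simp
  | insert a s ha hmax ih =>
    obtain rfl := hL.eq_before hr ha hmax
    calc c * ∑ i ∈ insert a (before r a), d i
        ≤ w a * ∑ i ∈ insert a (before r a), d i :=
          mul_le_mul_of_nonneg_right (hc a (Finset.mem_insert_self _ _)) (hd _ hL)
      _ = w a * d a + w a * ∑ i ∈ before r a, d i := by rw [Finset.sum_insert ha, mul_add]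
      _ ≤ w a * d a + ∑ i ∈ before r a, w i * d i := by
          gcongr
          exact ih (isInitialSegment_before a) fun i hi => hw (mem_before.1 hi)
      _ = ∑ i ∈ insert a (before r a), w i * d i := by rw [Finset.sum_insert ha]

theorem sum_nonpos_of_sum_mul_nonpos_of_isInitialSegment
    (hr : Function.Injective r) {w d : E → ℝ} (hw : Antivary w r)
    (hd : ∀ A, IsInitialSegment r A → 0 ≤ ∑ i ∈ A, d i) {L : Finset E}
    (hL : IsInitialSegment r L) (hpos : ∀ i ∈ L, 0 < w i) (hsum : ∑ i ∈ L, w i * d i ≤ 0) :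
    ∑ i ∈ L, d i ≤ 0 := by
  rcases L.eq_empty_or_nonempty with rfl | hne
  · simp
  · obtain ⟨a, ha, hmin⟩ := L.exists_min_image w hne
    exact nonpos_of_mul_nonpos_right
      ((mul_sum_le_sum_mul_of_isInitialSegment hr hw hd hL hmin).trans hsum) (hpos a ha)

end InitialSegment

section Greedy

variable {E : Type u} [Fintype E] [DecidableEq E] {α : Type*} [LinearOrder α]
  {f : Finset E → ℝ} {r : E → α}

/-- The greedy vector of a set function `f` for the ranking `r` of the agents: agent `i` receives
the marginal contribution of `i` to the set of the agents ranked before `i`. -/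
def greedy (f : Finset E → ℝ) (r : E → α) (i : E) : ℝ :=
  f (insert i (before r i)) - f (before r i)

theorem sum_greedy_of_isInitialSegment (hf : f ∅ = 0) (hr : Function.Injective r) {L : Finset E}
    (hL : IsInitialSegment r L) : ∑ i ∈ L, greedy f r i = f L := by
  induction L using Finset.induction_on_max_value r with
  | empty => simp [hf]
  | insert a s ha hmax ih =>
    obtain rfl := hL.eq_before hr ha hmax
    rw [Finset.sum_insert ha, ih (isInitialSegment_before a), greedy, sub_add_cancel]

theorem sum_greedy_le (hf : IsPolymatroidRank f) (hr : Function.Injective r) (A : Finset E) :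
    ∑ i ∈ A, greedy f r i ≤ f A := by
  induction A using Finset.induction_on_max_value r with
  | empty => simp [hf.empty]
  | insert a s ha hmax ih =>
    have hs := subset_before hr ha hmax
    have hsub := hf.submodular (insert a s) (before r a)
    rw [Finset.insert_union, Finset.union_eq_right.2 hs,
      Finset.insert_inter_of_notMem (by simp), Finset.inter_eq_left.2 hs] at hsub
    rw [Finset.sum_insert ha, greedy]
    linarith

theorem greedy_mem_independencePolytope (hf : IsPolymatroidRank f) (hr : Function.Injective r) :
    greedy f r ∈ independencePolytope f :=
  ⟨fun _ => sub_nonneg.2 (hf.mono _ _ (Finset.subset_insert _ _)), sum_greedy_le hf hr⟩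

theorem sum_greedy_sub_nonneg (hf : f ∅ = 0) (hr : Function.Injective r) {x : E → ℝ}
    (hx : ∀ A, ∑ i ∈ A, x i ≤ f A) {A : Finset E} (hA : IsInitialSegment r A) :
    0 ≤ ∑ i ∈ A, (greedy f r i - x i) := by
  rw [Finset.sum_sub_distrib, sum_greedy_of_isInitialSegment hf hr hA]
  exact sub_nonneg.2 (hx A)

theorem mul_sub_sum_le_sum_mul_greedy_sub (hf : f ∅ = 0) (hr : Function.Injective r)
    {w x : E → ℝ} (hw : Antivary w r) (hx : ∀ A, ∑ i ∈ A, x i ≤ f A) {c : ℝ}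
    (hc : ∀ i, c ≤ w i) :
    c * (f Finset.univ - ∑ i, x i) ≤ ∑ i, w i * greedy f r i - ∑ i, w i * x i := by
  have h := mul_sum_le_sum_mul_of_isInitialSegment hr hw
    (fun _ => sum_greedy_sub_nonneg hf hr hx) isInitialSegment_univ fun i _ => hc i
  simpa only [mul_sub, Finset.sum_sub_distrib,
    sum_greedy_of_isInitialSegment hf hr isInitialSegment_univ] using h

theorem sum_mul_le_sum_mul_greedy_of_nonneg (hf : f ∅ = 0) (hr : Function.Injective r)
    {w x : E → ℝ} (hw : Antivary w r) (hw₀ : ∀ i, 0 ≤ w i) (hx : ∀ A, ∑ i ∈ A, x i ≤ f A) :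
    ∑ i, w i * x i ≤ ∑ i, w i * greedy f r i := by
  simpa using mul_sub_sum_le_sum_mul_greedy_sub hf hr hw hx hw₀

theorem sum_mul_le_sum_mul_greedy_of_mem_basePolytope (hf : f ∅ = 0) (hr : Function.Injective r)
    {w x : E → ℝ} (hw : Antivary w r) (hx : x ∈ basePolytope f) :
    ∑ i, w i * x i ≤ ∑ i, w i * greedy f r i := by
  obtain ⟨c, hc⟩ := (Set.finite_range w).bddBelow
  simpa [hx.2] using
    mul_sub_sum_le_sum_mul_greedy_sub hf hr hw hx.1.2 fun i => hc (Set.mem_range_self i)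

theorem greedy_mem_optimalFace (hf : IsPolymatroidRank f) (hr : Function.Injective r)
    {w : E → ℝ} (hw : Antivary w r) (hw₀ : ∀ i, 0 ≤ w i) : greedy f r ∈ optimalFace f w :=
  ⟨greedy_mem_independencePolytope hf hr,
    fun _ hy => sum_mul_le_sum_mul_greedy_of_nonneg hf.empty hr hw hw₀ hy.2⟩

theorem greedy_minorRank_of_notMem {T L : Finset E} {i : E} (hi : i ∉ L) :
    greedy (minorRank f T L) r i = 0 := by
  rw [greedy, minorRank, minorRank, Finset.insert_inter_of_notMem hi, sub_self]

end Greedy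

section WeightRank

variable {E : Type u} {β : Type*}

/-- The ranking of the agents by decreasing weight, with ties broken by the ranking `q`. -/
def weightRank (w : E → ℝ) (q : E → β) (i : E) : ℝ ×ₗ β :=
  toLex (-w i, q i)

theorem weightRank_injective (w : E → ℝ) {q : E → β} (hq : Function.Injective q) :
    Function.Injective (weightRank w q) := fun _ _ h =>
  hq (Prod.ext_iff.1 (toLex.injective h)).2

variable [LinearOrder β]

theorem weightRank_lt_iff {w : E → ℝ} {q : E → β} {i j : E} :
    weightRank w q i < weightRank w q j ↔ w j < w i ∨ w i = w j ∧ q i < q j := by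
  simp [weightRank, Prod.Lex.toLex_lt_toLex]

theorem antivary_weightRank (w : E → ℝ) (q : E → β) : Antivary w (weightRank w q) :=
  fun _ _ h => (weightRank_lt_iff.1 h).elim le_of_lt fun h => h.1.ge

variable [Fintype E]

/-- The agents of weight `c`. -/
noncomputable def level (w : E → ℝ) (c : ℝ) : Finset E :=
  {i | w i = c}

/-- The agents of weight larger than `c`. -/
noncomputable def superlevel (w : E → ℝ) (c : ℝ) : Finset E :=
  {i | c < w i}

@[simp]
theorem mem_level {w : E → ℝ} {c : ℝ} {i : E} : i ∈ level w c ↔ w i = c := by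
  simp [level]

@[simp]
theorem mem_superlevel {w : E → ℝ} {c : ℝ} {i : E} : i ∈ superlevel w c ↔ c < w i := by
  simp [superlevel]

theorem disjoint_superlevel_level (w : E → ℝ) (c : ℝ) :
    Disjoint (superlevel w c) (level w c) :=
  Finset.disjoint_left.2 fun _ h h' => (mem_superlevel.1 h).ne' (mem_level.1 h')

theorem sum_superlevel_sub_mul (w d : E → ℝ) (c : ℝ) :
    ∑ i ∈ superlevel w c, (w i - c) * d i = ∑ i, w i * d i - ∑ i, min (w i) c * d i := by
  rw [superlevel, Finset.sum_filter, ← Finset.sum_sub_distrib]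
  refine Finset.sum_congr rfl fun i _ => ?_
  split_ifs with h
  · rw [min_eq_right h.le, sub_mul]
  · rw [min_eq_left (not_lt.1 h), sub_self]

theorem isInitialSegment_superlevel (w : E → ℝ) (q : E → β) (c : ℝ) :
    IsInitialSegment (weightRank w q) (superlevel w c) := fun _ hi _ hj =>
  mem_superlevel.2
    ((mem_superlevel.1 hi).trans_le (antivary_weightRank w q (mem_before.1 hj)))

theorem exists_injective_isInitialSegment (S : Finset E) :
    ∃ q : E → ℝ ×ₗ Fin (Fintype.card E), Function.Injective q ∧ IsInitialSegment q S := by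
  classical
  let w : E → ℝ := fun i => if i ∈ S then 1 else 0
  have hw : superlevel w 0 = S := by
    ext i
    by_cases hi : i ∈ S <;> simp [w, hi]
  exact ⟨weightRank w (Fintype.equivFin E), weightRank_injective w (Fintype.equivFin E).injective,
    hw ▸ isInitialSegment_superlevel w _ 0⟩

variable [DecidableEq E]

theorem greedy_weightRank (f : Finset E → ℝ) (w : E → ℝ) (q : E → β) (i : E) :
    greedy f (weightRank w q) i =
      greedy (minorRank f (superlevel w (w i)) (level w (w i))) q i := by
  have hbefore : before (weightRank w q) i =
      superlevel w (w i) ∪ (before q i ∩ level w (w i)) := by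
    ext j
    simp [weightRank_lt_iff, and_comm]
  rw [greedy, greedy, minorRank, minorRank, Finset.insert_inter_of_mem (by simp),
    Finset.union_insert, hbefore, sub_sub_sub_cancel_right]

end WeightRank

section OptimalFace

variable {E : Type u} [Fintype E] [DecidableEq E] {f : Finset E → ℝ} {w : E → ℝ}

/-- Split the weights as `w = min w c + (w - c)⁺`. Greedy is optimal for both summands, so an
optimum for `w` is as good as greedy for `(w - c)⁺`, whose support is the superlevel set. -/
theorem sum_superlevel_of_mem_optimalFace (hf : IsPolymatroidRank f) (hw : ∀ i, 0 ≤ w i)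
    {x : E → ℝ} (hx : x ∈ optimalFace f w) {c : ℝ} (hc : 0 ≤ c) :
    ∑ i ∈ superlevel w c, x i = f (superlevel w c) := by
  let q := Fintype.equivFin E
  have hr := weightRank_injective w q.injective
  have hanti := antivary_weightRank w q
  have hT := isInitialSegment_superlevel w q c
  set g := greedy f (weightRank w q)
  have hmin : ∑ i, min (w i) c * x i ≤ ∑ i, min (w i) c * g i :=
    sum_mul_le_sum_mul_greedy_of_nonneg hf.empty hr
      (hanti.comp_monotone_left fun _ _ h => min_le_min_right c h) (fun i => le_min (hw i) hc)
      hx.1.2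
  have hopt : ∑ i, w i * g i ≤ ∑ i, w i * x i := hx.2 g (greedy_mem_independencePolytope hf hr)
  have hexcess : ∑ i ∈ superlevel w c, (w i - c) * (g i - x i) ≤ 0 := by
    rw [sum_superlevel_sub_mul]
    simp only [mul_sub, Finset.sum_sub_distrib]
    linarith
  have hdiff := sum_nonpos_of_sum_mul_nonpos_of_isInitialSegment hr
    (hanti.comp_monotone_left fun _ _ h => sub_le_sub_right h c)
    (fun _ => sum_greedy_sub_nonneg hf.empty hr hx.1.2) hT
    (fun i hi => sub_pos.2 (mem_superlevel.1 hi)) hexcess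
  rw [Finset.sum_sub_distrib, sum_greedy_of_isInitialSegment hf.empty hr hT] at hdiff
  exact (hx.1.2 (superlevel w c)).antisymm (sub_nonpos.1 hdiff)

theorem sum_level_le_minorRank (hf : IsPolymatroidRank f) (hw : ∀ i, 0 ≤ w i) {x : E → ℝ}
    (hx : x ∈ optimalFace f w) {c : ℝ} (hc : 0 ≤ c) (S : Finset E) :
    ∑ i ∈ S ∩ level w c, x i ≤
      minorRank f (superlevel w c) (level w c) S := by
  have hdisj : Disjoint (superlevel w c) (S ∩ level w c) :=
    (disjoint_superlevel_level w c).mono_right Finset.inter_subset_right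
  have h := hx.1.2 (superlevel w c ∪ (S ∩ level w c))
  rw [Finset.sum_union hdisj, sum_superlevel_of_mem_optimalFace hf hw hx hc] at h
  exact le_sub_iff_add_le'.2 h

theorem sum_level_greedy_weightRank {β : Type*} [LinearOrder β] {q : E → β}
    (hq : Function.Injective q) (w : E → ℝ) (c : ℝ) {S : Finset E} (hS : IsInitialSegment q S) :
    ∑ i ∈ S ∩ level w c, greedy f (weightRank w q) i =
      minorRank f (superlevel w c) (level w c) S := by
  calc ∑ i ∈ S ∩ level w c, greedy f (weightRank w q) i
      = ∑ i ∈ S ∩ level w c,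
          greedy (minorRank f (superlevel w c) (level w c)) q i :=
        Finset.sum_congr rfl fun i hi => by
          obtain rfl : w i = c := mem_level.1 (Finset.mem_inter.1 hi).2
          exact greedy_weightRank f w q i
    _ = ∑ i ∈ S, greedy (minorRank f (superlevel w c) (level w c)) q i :=
        Finset.sum_subset Finset.inter_subset_left fun i hi hi' =>
          greedy_minorRank_of_notMem fun h => hi' (Finset.mem_inter.2 ⟨hi, h⟩)
    _ = minorRank f (superlevel w c) (level w c) S :=
        sum_greedy_of_isInitialSegment (by simp [minorRank]) hq hS

theorem isGreatest_sum_level_optimalFace (hf : IsPolymatroidRank f) (hw : ∀ i, 0 ≤ w i) {c : ℝ}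
    (hc : 0 ≤ c) (S : Finset E) :
    IsGreatest ((fun x : E → ℝ => ∑ i ∈ S ∩ level w c, x i) '' optimalFace f w)
      (minorRank f (superlevel w c) (level w c) S) := by
  obtain ⟨q, hq, hS⟩ := exists_injective_isInitialSegment S
  refine ⟨⟨greedy f (weightRank w q), ?_, sum_level_greedy_weightRank hq w c hS⟩, ?_⟩
  · exact greedy_mem_optimalFace hf (weightRank_injective w hq) (antivary_weightRank w q) hw
  · rintro _ ⟨x, hx, rfl⟩
    exact sum_level_le_minorRank hf hw hx hc S

end OptimalFace

section BasePolytope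

variable {E : Type u} [Fintype E] [DecidableEq E]

theorem finite_range_greedy {ι α : Type*} [LinearOrder α] (f : Finset E → ℝ) (r : ι → E → α) :
    (Set.range fun s => greedy f (r s)).Finite := by
  refine (Set.finite_range fun (B : E → Finset E) i => f (insert i (B i)) - f (B i)).subset ?_
  rintro _ ⟨s, rfl⟩
  exact ⟨before (r s), rfl⟩

theorem basePolytope_subset_convexHull_greedy {f : Finset E → ℝ} (hf : f ∅ = 0) {β : Type*}
    [LinearOrder β] {q : E → β} (hq : Function.Injective q) :
    basePolytope f ⊆ convexHull ℝ (Set.range fun w : E → ℝ => greedy f (weightRank w q)) := by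
  intro y hy
  by_contra hyc
  obtain ⟨φ, b, hφ, hb⟩ := geometric_hahn_banach_closed_point (convex_convexHull ℝ _)
    ((finite_range_greedy f fun w => weightRank w q).isClosed_convexHull ℝ) hyc
  let w : E → ℝ := fun i => φ fun j => if i = j then 1 else 0
  have hφw : ∀ z, φ z = ∑ i, w i * z i := fun z => by
    simpa [mul_comm] using LinearMap.pi_apply_eq_sum_univ φ.toLinearMap z
  refine lt_irrefl b ?_
  calc b < ∑ i, w i * y i := hφw y ▸ hb
    _ ≤ ∑ i, w i * greedy f (weightRank w q) i :=
      sum_mul_le_sum_mul_greedy_of_mem_basePolytope hf (weightRank_injective w hq)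
        (antivary_weightRank w q) hy
    _ < b := hφw (greedy f (weightRank w q)) ▸ hφ _ (subset_convexHull ℝ _ ⟨w, rfl⟩)

end BasePolytope

section Bucket

variable {ε V : ℝ} {K : ℕ} {m : Fin K → ℝ} {k : Fin K} {t : ℝ}

theorem bucket_unique (hε : 0 ≤ ε) {j k : Fin K} (hj : t ∈ bucket ε V j)
    (hk : t ∈ bucket ε V k) : j = k := by
  have not_lt : ∀ {j k : Fin K}, t ∈ bucket ε V j → t ∈ bucket ε V k → ¬ j < k := by
    rintro j k ⟨-, hlt | ⟨hlast, -⟩⟩ ⟨hle, -⟩ hjk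
    · have hpow : (1 + ε) ^ ((j : ℕ) + 1) ≤ (1 + ε) ^ (k : ℕ) :=
        pow_le_pow_right₀ (le_add_of_nonneg_right hε) hjk
      exact (hlt.trans_le (hpow.trans hle)).false
    · exact (hlast.symm.trans_le (Nat.succ_le_of_lt hjk)).not_gt k.isLt
  exact (le_of_not_gt (not_lt hk hj)).antisymm (le_of_not_gt (not_lt hj hk))

theorem measurableSet_bucket (ε V : ℝ) (k : Fin K) : MeasurableSet (bucket ε V k) :=
  measurableSet_Ici.inter
    (measurableSet_Iio.union ((MeasurableSet.const _).inter (measurableSet_singleton V)))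

theorem measurable_canonicalValue (ε V : ℝ) (m : Fin K → ℝ) : Measurable (canonicalValue ε V m) :=
  Finset.measurable_fun_sum _ fun k _ => measurable_const.indicator (measurableSet_bucket ε V k)

theorem canonicalValue_nonneg (hm : ∀ k, 0 ≤ m k) (t : ℝ) : 0 ≤ canonicalValue ε V m t :=
  Finset.sum_nonneg fun k _ => Set.indicator_nonneg (fun _ _ => hm k) _

theorem canonicalValue_of_mem_bucket (hε : 0 ≤ ε) (m : Fin K → ℝ) (h : t ∈ bucket ε V k) :
    canonicalValue ε V m t = m k := by
  rw [canonicalValue, Finset.sum_eq_single_of_mem k (Finset.mem_univ k), Set.indicator_of_mem h]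
  exact fun j _ hj => Set.indicator_of_notMem (fun h' => hj (bucket_unique hε h' h)) _

theorem exists_mem_bucket_of_canonicalValue_ne_zero (h : canonicalValue ε V m t ≠ 0) :
    ∃ j : Fin K, t ∈ bucket ε V j := by
  obtain ⟨j, -, hj⟩ := Finset.exists_ne_zero_of_sum_ne_zero h
  exact ⟨j, Set.mem_of_indicator_ne_zero hj⟩

theorem canonicalValue_eq_iff (hε : 0 ≤ ε) (hm : Function.Injective m) (hk : m k ≠ 0) :
    canonicalValue ε V m t = m k ↔ t ∈ bucket ε V k := by
  refine ⟨fun h => ?_, canonicalValue_of_mem_bucket hε m⟩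
  obtain ⟨j, hj⟩ := exists_mem_bucket_of_canonicalValue_ne_zero (h.trans_ne hk)
  exact hm ((canonicalValue_of_mem_bucket hε m hj).symm.trans h) ▸ hj

theorem lt_canonicalValue_iff (hε : 0 ≤ ε) (hm : StrictMono m) (hk : 0 ≤ m k) :
    m k < canonicalValue ε V m t ↔ ∃ j, k < j ∧ t ∈ bucket ε V j := by
  constructor
  · intro h
    obtain ⟨j, hj⟩ := exists_mem_bucket_of_canonicalValue_ne_zero (hk.trans_lt h).ne'
    rw [canonicalValue_of_mem_bucket hε m hj] at h
    exact ⟨j, hm.lt_iff_lt.1 h, hj⟩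
  · rintro ⟨j, hkj, hj⟩
    rw [canonicalValue_of_mem_bucket hε m hj]
    exact hm hkj

variable {E : Type u} [Fintype E]

theorem level_canonicalValue (hε : 0 ≤ ε) (hm : Function.Injective m) (hk : m k ≠ 0)
    (μ : E → ℝ) : level (fun i => canonicalValue ε V m (μ i)) (m k) = agentsIn ε V μ k := by
  ext i
  simp [agentsIn, canonicalValue_eq_iff hε hm hk]

theorem superlevel_canonicalValue (hε : 0 ≤ ε) (hm : StrictMono m) (hk : 0 ≤ m k) (μ : E → ℝ) :
    superlevel (fun i => canonicalValue ε V m (μ i)) (m k) = agentsAbove ε V μ k := by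
  ext i
  simp [agentsAbove, lt_canonicalValue_iff hε hm hk]

theorem measurableSet_mem_agentsIn (ε V : ℝ) (k : Fin K) (i : E) :
    MeasurableSet {μ : E → ℝ | i ∈ agentsIn ε V μ k} := by
  simp only [agentsIn, Finset.mem_filter, Finset.mem_univ, true_and]
  exact (measurableSet_bucket ε V k).preimage (measurable_pi_apply i)

theorem measurableSet_mem_agentsAbove (ε V : ℝ) (k : Fin K) (i : E) :
    MeasurableSet {μ : E → ℝ | i ∈ agentsAbove ε V μ k} := by
  simp only [agentsAbove, Finset.mem_filter, Finset.mem_univ, true_and, Set.ofPred_exists]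
  exact MeasurableSet.iUnion fun j => (MeasurableSet.const _).inter
    ((measurableSet_bucket ε V j).preimage (measurable_pi_apply i))

end Bucket

section FakeUtility

variable {E : Type u} {ε V : ℝ} {K : ℕ} {m : Fin K → ℝ} {k : Fin K}

theorem fakeUtility_mem_Icc (hk : 0 ≤ m k) (μ : E → ℝ) {x : E → ℝ} {i : E} {b : ℝ}
    (hx : x i ∈ Set.Icc 0 b) : fakeUtility ε V m k μ x i ∈ Set.Icc 0 (m k * b) := by
  rw [fakeUtility]
  split_ifs
  · exact ⟨mul_nonneg hk hx.1, mul_le_mul_of_nonneg_left hx.2 hk⟩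
  · exact ⟨le_rfl, mul_nonneg hk (hx.1.trans hx.2)⟩

theorem fakeUtility_smul_add_smul (m : Fin K → ℝ) (k : Fin K) (μ x y : E → ℝ) (a b : ℝ) (i : E) :
    fakeUtility ε V m k μ (a • x + b • y) i =
      a * fakeUtility ε V m k μ x i + b * fakeUtility ε V m k μ y i := by
  simp only [fakeUtility, Pi.add_apply, Pi.smul_apply, smul_eq_mul]
  split_ifs <;> ring

variable [Fintype E] [DecidableEq E]

theorem sum_fakeUtility (m : Fin K → ℝ) (k : Fin K) (μ x : E → ℝ) (S : Finset E) :
    ∑ i ∈ S, fakeUtility ε V m k μ x i = m k * ∑ i ∈ S ∩ agentsIn ε V μ k, x i := by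
  simp [fakeUtility, agentsIn, Finset.mul_sum, Finset.inter_filter, Finset.sum_filter]

end FakeUtility

section GHat

variable {E : Type u} [Fintype E] [DecidableEq E] {f : Finset E → ℝ} {ε V : ℝ} {K : ℕ}
  {m : Fin K → ℝ}

theorem isGreatest_sum_fakeUtility (hf : IsPolymatroidRank f) (hε : 0 ≤ ε) (hm₀ : ∀ k, 0 < m k)
    (hm : StrictMono m) (k : Fin K) (μ : E → ℝ) (S : Finset E) :
    IsGreatest ((fun x : E → ℝ => ∑ i ∈ S, fakeUtility ε V m k μ x i) ''
        receiverAllocations f ε V m μ)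
      (m k * minorRank f (agentsAbove ε V μ k) (agentsIn ε V μ k) S) := by
  have h := isGreatest_sum_level_optimalFace hf
    (fun i => canonicalValue_nonneg (ε := ε) (V := V) (fun j => (hm₀ j).le) (μ i)) (hm₀ k).le S
  rw [level_canonicalValue hε hm.injective (hm₀ k).ne',
    superlevel_canonicalValue hε hm (hm₀ k).le] at h
  simp only [sum_fakeUtility]
  simpa only [Set.image_image, receiverAllocations] using
    (monotone_mul_left_of_nonneg (hm₀ k).le).map_isGreatest h

theorem gHat_eq (hf : IsPolymatroidRank f) (hε : 0 ≤ ε) (hm₀ : ∀ k, 0 < m k) (hm : StrictMono m)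
    (k : Fin K) (μ : E → ℝ) :
    gHat f ε V m k μ =
      fun S => m k * minorRank f (agentsAbove ε V μ k) (agentsIn ε V μ k) S :=
  funext fun S => (isGreatest_sum_fakeUtility hf hε hm₀ hm k μ S).csSup_eq

theorem isGreatest_gHat (hf : IsPolymatroidRank f) (hε : 0 ≤ ε) (hm₀ : ∀ k, 0 < m k)
    (hm : StrictMono m) (k : Fin K) (μ : E → ℝ) (S : Finset E) :
    IsGreatest ((fun x : E → ℝ => ∑ i ∈ S, fakeUtility ε V m k μ x i) ''
      receiverAllocations f ε V m μ) (gHat f ε V m k μ S) := by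
  rw [gHat_eq hf hε hm₀ hm]
  exact isGreatest_sum_fakeUtility hf hε hm₀ hm k μ S

theorem isPolymatroidRank_gHat (hf : IsPolymatroidRank f) (hε : 0 ≤ ε) (hm₀ : ∀ k, 0 < m k)
    (hm : StrictMono m) (k : Fin K) (μ : E → ℝ) : IsPolymatroidRank (gHat f ε V m k μ) := by
  rw [gHat_eq hf hε hm₀ hm]
  exact (hf.minorRank _ _).const_mul (hm₀ k).le

theorem gHat_le (hf : IsPolymatroidRank f) (hε : 0 ≤ ε) (hm₀ : ∀ k, 0 < m k)
    (hm : StrictMono m) (k : Fin K) (μ : E → ℝ) (S : Finset E) :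
    gHat f ε V m k μ S ≤ m k * f S := by
  rw [gHat_eq hf hε hm₀ hm]
  exact mul_le_mul_of_nonneg_left (hf.minorRank_le _ _ S) (hm₀ k).le

end GHat

section Measurability

variable {E : Type u}

theorem measurable_comp_finset [Finite E] {Ω γ : Type*} [MeasurableSpace Ω] [MeasurableSpace γ]
    (F : Finset E → γ) {A : Ω → Finset E} (hA : ∀ i, MeasurableSet {ω | i ∈ A ω}) :
    Measurable fun ω => F (A ω) := by
  let _ : MeasurableSpace (Finset E) := ⊤
  refine measurable_from_top.comp (measurable_to_countable' fun B => ?_)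
  have h : A ⁻¹' {B} = ⋂ i, {ω | i ∈ A ω ↔ i ∈ B} := by
    ext ω
    simp [Finset.ext_iff]
  rw [h]
  exact MeasurableSet.iInter fun i => (hA i).iff (MeasurableSet.const _)

variable [Fintype E] [DecidableEq E]

theorem measurable_greedy_weightRank {β : Type*} [LinearOrder β] (f : Finset E → ℝ) (q : E → β) :
    Measurable fun w : E → ℝ => greedy f (weightRank w q) := by
  have hbefore : ∀ i j, MeasurableSet {w : E → ℝ | j ∈ before (weightRank w q) i} := by
    intro i j
    simp only [mem_before, weightRank_lt_iff]
    have hi := measurable_pi_apply (X := fun _ : E => ℝ) i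
    have hj := measurable_pi_apply (X := fun _ : E => ℝ) j
    exact (measurableSet_lt hi hj).union
      ((measurableSet_eq_fun hj hi).inter (MeasurableSet.const _))
  refine measurable_pi_lambda _ fun i => ?_
  exact (measurable_comp_finset (fun A => f (insert i A)) (hbefore i)).sub
    (measurable_comp_finset f (hbefore i))

theorem measurable_gHat {f : Finset E → ℝ} (hf : IsPolymatroidRank f) {ε V : ℝ} (hε : 0 ≤ ε)
    {K : ℕ} {m : Fin K → ℝ} (hm₀ : ∀ k, 0 < m k) (hm : StrictMono m) (k : Fin K) (S : Finset E) :
    Measurable fun μ => gHat f ε V m k μ S := by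
  simp only [gHat_eq hf hε hm₀ hm, minorRank]
  have habove := measurableSet_mem_agentsAbove (E := E) ε V k
  have hin := measurableSet_mem_agentsIn (E := E) ε V k
  refine ((measurable_comp_finset f fun i => ?_).sub
    (measurable_comp_finset f habove)).const_mul (m k)
  simp only [Finset.mem_union, Finset.mem_inter]
  exact (habove i).union ((MeasurableSet.const _).inter (hin i))

end Measurability

section GreedyAllocation

variable {E : Type u} [Fintype E] [DecidableEq E] {f : Finset E → ℝ} {ε V : ℝ} {K : ℕ}
  {m : Fin K → ℝ} {β : Type*} [LinearOrder β] {q : E → β}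

/-- The greedy allocation of the receiver at posterior means `μ`: the agents are served by
decreasing canonical value, with ties broken by the ranking `q`. -/
noncomputable def greedyAllocation (f : Finset E → ℝ) (ε V : ℝ) {K : ℕ} (m : Fin K → ℝ) (q : E → β)
    (μ : E → ℝ) : E → ℝ :=
  greedy f (weightRank (fun i => canonicalValue ε V m (μ i)) q)

theorem greedyAllocation_mem_receiverAllocations (hf : IsPolymatroidRank f) (hm₀ : ∀ k, 0 ≤ m k)
    (hq : Function.Injective q) (μ : E → ℝ) :
    greedyAllocation f ε V m q μ ∈ receiverAllocations f ε V m μ :=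
  greedy_mem_optimalFace hf (weightRank_injective _ hq) (antivary_weightRank _ q)
    fun i => canonicalValue_nonneg hm₀ (μ i)

theorem measurable_greedyAllocation (f : Finset E → ℝ) (ε V : ℝ) {K : ℕ} (m : Fin K → ℝ)
    (q : E → β) : Measurable (greedyAllocation f ε V m q) :=
  (measurable_greedy_weightRank f q).comp <| measurable_pi_lambda _ fun i =>
    (measurable_canonicalValue ε V m).comp (measurable_pi_apply i)

theorem fakeUtility_greedyAllocation (hf : IsPolymatroidRank f) (hε : 0 ≤ ε)
    (hm₀ : ∀ k, 0 < m k) (hm : StrictMono m) (k : Fin K) (q : E → β) (μ : E → ℝ) (i : E) :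
    fakeUtility ε V m k μ (greedyAllocation f ε V m q μ) i = greedy (gHat f ε V m k μ) q i := by
  have hscale : greedy (gHat f ε V m k μ) q i =
      m k * greedy (minorRank f (agentsAbove ε V μ k) (agentsIn ε V μ k)) q i := by
    rw [gHat_eq hf hε hm₀ hm, greedy, greedy, mul_sub]
  rw [hscale, fakeUtility]
  split_ifs with hi
  · rw [greedyAllocation, greedy_weightRank, canonicalValue_of_mem_bucket hε m hi,
      level_canonicalValue hε hm.injective (hm₀ k).ne',
      superlevel_canonicalValue hε hm (hm₀ k).le]
  · rw [greedy_minorRank_of_notMem (by simpa [agentsIn] using hi), mul_zero]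

end GreedyAllocation

section Posterior

theorem ae_integral_posterior_mem_Icc {S : Type*} [MeasurableSpace S] (κ : Kernel ℝ S)
    [IsMarkovKernel κ] (P : Measure ℝ) [IsFiniteMeasure P] {a b : ℝ}
    (hP : ∀ᵐ t ∂P, t ∈ Set.Icc a b) :
    ∀ᵐ s ∂(P.bind κ), ∫ t, t ∂(posterior κ P s) ∈ Set.Icc a b := by
  have hposterior : ∀ᵐ s ∂(P.bind κ), ∀ᵐ t ∂(posterior κ P s), t ∈ Set.Icc a b :=
    Measure.ae_ae_of_ae_comp (by rwa [posterior_comp_self])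
  filter_upwards [hposterior] with s hs
  exact (convex_Icc a b).integral_mem isClosed_Icc hs
    (Integrable.of_mem_Icc a b aemeasurable_id hs)

end Posterior

namespace MappingRule

variable {E : Type u} (Δ : MappingRule.{u, v} E) (D : E → Measure ℝ)
  [∀ i, IsFiniteMeasure (D i)]

theorem measurable_posteriorMean : Measurable (Δ.posteriorMean D) :=
  measurable_pi_lambda _ fun i =>
    (StronglyMeasurable.integral_kernel (κ := posterior (Δ.kernel i) (D i))
      stronglyMeasurable_id).measurable.comp (measurable_pi_apply i)

variable [Fintype E]

instance isFiniteMeasure_signalLaw : IsFiniteMeasure (Δ.signalLaw D) := by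
  unfold signalLaw
  infer_instance

theorem ae_posteriorMean_mem_Icc {a b : ℝ} (hD : ∀ i, ∀ᵐ t ∂(D i), t ∈ Set.Icc a b) :
    ∀ᵐ σ ∂(Δ.signalLaw D), ∀ i, Δ.posteriorMean D σ i ∈ Set.Icc a b :=
  ae_all_iff.2 fun i =>
    (Measure.quasiMeasurePreserving_eval (μ := fun i => (D i).bind (Δ.kernel i)) i).ae
      (ae_integral_posterior_mem_Icc (Δ.kernel i) (D i) (hD i))

end MappingRule

section SelectionRule

variable {E : Type u} [Fintype E] {f : Finset E → ℝ} {ε V : ℝ} {K : ℕ} {m : Fin K → ℝ}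
  {D : E → Measure ℝ} [∀ i, IsFiniteMeasure (D i)]

namespace MappingRule

variable {Δ : MappingRule.{u, v} E}

theorem convex_setOf_isSelectionRule (Δ : MappingRule.{u, v} E) (D : E → Measure ℝ)
    [∀ i, IsFiniteMeasure (D i)] (f : Finset E → ℝ) (ε V : ℝ) (m : Fin K → ℝ) :
    Convex ℝ {x | Δ.IsSelectionRule D f ε V m x} := by
  refine fun x hx y hy a b ha hb hab => ⟨(hx.1.const_smul a).add (hy.1.const_smul b), ?_⟩
  filter_upwards [hx.2, hy.2] with σ hxσ hyσ
  exact convex_optimalFace f _ hxσ hyσ ha hb hab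

theorem IsSelectionRule.integrable_fakeUtility {x : (∀ i, Δ.Signal i) → E → ℝ}
    (hx : Δ.IsSelectionRule D f ε V m x) {k : Fin K} (hk : 0 ≤ m k) (i : E) :
    Integrable (fun σ => fakeUtility ε V m k (Δ.posteriorMean D σ) (x σ) i) (Δ.signalLaw D) := by
  have hmeas : Measurable fun σ => fakeUtility ε V m k (Δ.posteriorMean D σ) (x σ) i :=
    Measurable.ite
      ((measurableSet_bucket ε V k).preimage
        ((measurable_pi_apply i).comp (Δ.measurable_posteriorMean D)))
      (((measurable_pi_apply i).comp hx.1).const_mul (m k)) measurable_const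
  exact Integrable.of_mem_Icc 0 (m k * f {i}) hmeas.aemeasurable <| hx.2.mono fun σ hσ =>
    fakeUtility_mem_Icc hk _ (mem_Icc_of_mem_independencePolytope hσ.1 i)

theorem IsSelectionRule.integral_fakeUtility_smul_add_smul {x y : (∀ i, Δ.Signal i) → E → ℝ}
    (hx : Δ.IsSelectionRule D f ε V m x) (hy : Δ.IsSelectionRule D f ε V m y) {k : Fin K}
    (hk : 0 ≤ m k) (a b : ℝ) (i : E) :
    ∫ σ, fakeUtility ε V m k (Δ.posteriorMean D σ) (a • x σ + b • y σ) i ∂(Δ.signalLaw D) =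
      a * ∫ σ, fakeUtility ε V m k (Δ.posteriorMean D σ) (x σ) i ∂(Δ.signalLaw D) +
        b * ∫ σ, fakeUtility ε V m k (Δ.posteriorMean D σ) (y σ) i ∂(Δ.signalLaw D) := by
  simp only [fakeUtility_smul_add_smul]
  rw [integral_add ((hx.integrable_fakeUtility hk i).const_mul a)
    ((hy.integrable_fakeUtility hk i).const_mul b), integral_const_mul, integral_const_mul]

variable [DecidableEq E]

theorem isSelectionRule_greedyAllocation (Δ : MappingRule.{u, v} E) (D : E → Measure ℝ)
    [∀ i, IsFiniteMeasure (D i)] (hf : IsPolymatroidRank f) (ε V : ℝ) (hm₀ : ∀ k, 0 ≤ m k)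
    {β : Type*} [LinearOrder β] {q : E → β} (hq : Function.Injective q) :
    Δ.IsSelectionRule D f ε V m fun σ => greedyAllocation f ε V m q (Δ.posteriorMean D σ) :=
  ⟨(measurable_greedyAllocation f ε V m q).comp (Δ.measurable_posteriorMean D),
    .of_forall fun _ => greedyAllocation_mem_receiverAllocations hf hm₀ hq _⟩

theorem integrable_gHat (Δ : MappingRule.{u, v} E) (D : E → Measure ℝ)
    [∀ i, IsFiniteMeasure (D i)] (hf : IsPolymatroidRank f) (V : ℝ) (hε : 0 ≤ ε)
    (hm₀ : ∀ k, 0 < m k) (hm : StrictMono m) (k : Fin K) (S : Finset E) :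
    Integrable (fun σ => gHat f ε V m k (Δ.posteriorMean D σ) S) (Δ.signalLaw D) :=
  Integrable.of_mem_Icc 0 (m k * f S)
    ((measurable_gHat hf hε hm₀ hm k S).comp (Δ.measurable_posteriorMean D)).aemeasurable
    (.of_forall fun _ => ⟨(isPolymatroidRank_gHat hf hε hm₀ hm k _).nonneg S,
      gHat_le hf hε hm₀ hm k _ S⟩)

end MappingRule

variable {Δ : Fin K → MappingRule.{u, v} E}

theorem expectedFakeUtility_smul_add_smul (hm₀ : ∀ k, 0 ≤ m k)
    {x y : ∀ k, (∀ i, (Δ k).Signal i) → E → ℝ}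
    (hx : ∀ k, (Δ k).IsSelectionRule D f ε V m (x k))
    (hy : ∀ k, (Δ k).IsSelectionRule D f ε V m (y k)) (a b : ℝ) :
    expectedFakeUtility Δ D ε V m (a • x + b • y) =
      a • expectedFakeUtility Δ D ε V m x + b • expectedFakeUtility Δ D ε V m y := by
  funext i
  simp only [expectedFakeUtility, Pi.add_apply, Pi.smul_apply, smul_eq_mul,
    (hx _).integral_fakeUtility_smul_add_smul (hy _) (hm₀ _), Finset.sum_add_distrib,
    ← Finset.mul_sum]
  ring

theorem sum_expectedFakeUtility (hm₀ : ∀ k, 0 ≤ m k) {x : ∀ k, (∀ i, (Δ k).Signal i) → E → ℝ}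
    (hx : ∀ k, (Δ k).IsSelectionRule D f ε V m (x k)) (S : Finset E) :
    ∑ i ∈ S, expectedFakeUtility Δ D ε V m x i = (1 / (K : ℝ)) * ∑ k,
      ∫ σ, ∑ i ∈ S, fakeUtility ε V m k ((Δ k).posteriorMean D σ) (x k σ) i
        ∂((Δ k).signalLaw D) := by
  simp only [expectedFakeUtility, ← Finset.mul_sum]
  rw [Finset.sum_comm]
  congr! 2 with k
  exact (integral_finsetSum S fun i _ => (hx k).integrable_fakeUtility (hm₀ k) i).symm

theorem convex_achievableFakeUtilities (Δ : Fin K → MappingRule.{u, v} E) (D : E → Measure ℝ)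
    [∀ i, IsFiniteMeasure (D i)] (f : Finset E → ℝ) (ε V : ℝ) (hm₀ : ∀ k, 0 ≤ m k) :
    Convex ℝ (achievableFakeUtilities Δ D f ε V m) := by
  rintro _ ⟨x, hx, rfl⟩ _ ⟨y, hy, rfl⟩ a b ha hb hab
  exact ⟨a • x + b • y,
    fun k => MappingRule.convex_setOf_isSelectionRule (Δ k) D f ε V m (hx k) (hy k) ha hb hab,
    (expectedFakeUtility_smul_add_smul hm₀ hx hy a b).symm⟩

end SelectionRule

section RankHat

variable {E : Type u} [Fintype E] [DecidableEq E] {f : Finset E → ℝ} {ε V : ℝ} {K : ℕ}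
  {m : Fin K → ℝ} {D : E → Measure ℝ} [∀ i, IsFiniteMeasure (D i)]
  {Δ : Fin K → MappingRule.{u, v} E}

theorem isPolymatroidRank_rankHat (hf : IsPolymatroidRank f) (hε : 0 ≤ ε) (hm₀ : ∀ k, 0 < m k)
    (hm : StrictMono m) : IsPolymatroidRank (rankHat Δ D f ε V m) :=
  IsPolymatroidRank.const_mul
    (.sum fun k _ => .integral (.of_forall fun _ => isPolymatroidRank_gHat hf hε hm₀ hm k _)
      ((Δ k).integrable_gHat D hf V hε hm₀ hm k)) (by positivity)

theorem achievableFakeUtilities_subset_independencePolytope (hf : IsPolymatroidRank f)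
    (hε : 0 ≤ ε) (hm₀ : ∀ k, 0 < m k) (hm : StrictMono m) :
    achievableFakeUtilities Δ D f ε V m ⊆ independencePolytope (rankHat Δ D f ε V m) := by
  rintro _ ⟨x, hx, rfl⟩
  have hm₀' : ∀ k, 0 ≤ m k := fun k => (hm₀ k).le
  constructor
  · refine fun i => mul_nonneg (by positivity) <|
      Finset.sum_nonneg fun k _ => integral_nonneg_of_ae ?_
    filter_upwards [(hx k).2] with σ hσ
    exact (fakeUtility_mem_Icc (hm₀' k) _ (mem_Icc_of_mem_independencePolytope hσ.1 i)).1
  · intro S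
    rw [sum_expectedFakeUtility hm₀' hx, rankHat]
    refine mul_le_mul_of_nonneg_left (Finset.sum_le_sum fun k _ => ?_) (by positivity)
    refine integral_mono_ae
      (integrable_finsetSum S fun i _ => (hx k).integrable_fakeUtility (hm₀' k) i)
      ((Δ k).integrable_gHat D hf V hε hm₀ hm k S) ?_
    filter_upwards [(hx k).2] with σ hσ
    exact (isGreatest_gHat hf hε hm₀ hm k _ S).2 ⟨x k σ, hσ, rfl⟩

theorem expectedFakeUtility_greedyAllocation (hf : IsPolymatroidRank f) (hε : 0 ≤ ε)
    (hm₀ : ∀ k, 0 < m k) (hm : StrictMono m) {β : Type*} [LinearOrder β] (q : E → β) :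
    expectedFakeUtility Δ D ε V m
        (fun k σ => greedyAllocation f ε V m q ((Δ k).posteriorMean D σ)) =
      greedy (rankHat Δ D f ε V m) q := by
  funext i
  rw [greedy, rankHat, rankHat, ← mul_sub, ← Finset.sum_sub_distrib, expectedFakeUtility]
  congr! 2 with k
  rw [← integral_sub ((Δ k).integrable_gHat D hf V hε hm₀ hm k _)
    ((Δ k).integrable_gHat D hf V hε hm₀ hm k _)]
  simp only [fakeUtility_greedyAllocation hf hε hm₀ hm, greedy]

theorem greedy_rankHat_mem_achievableFakeUtilities (hf : IsPolymatroidRank f) (hε : 0 ≤ ε)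
    (hm₀ : ∀ k, 0 < m k) (hm : StrictMono m) {β : Type*} [LinearOrder β] {q : E → β}
    (hq : Function.Injective q) :
    greedy (rankHat Δ D f ε V m) q ∈ achievableFakeUtilities Δ D f ε V m :=
  ⟨_, fun k => (Δ k).isSelectionRule_greedyAllocation D hf ε V (fun j => (hm₀ j).le) hq,
    (expectedFakeUtility_greedyAllocation hf hε hm₀ hm q).symm⟩

theorem basePolytope_subset_achievableFakeUtilities (hf : IsPolymatroidRank f) (hε : 0 ≤ ε)
    (hm₀ : ∀ k, 0 < m k) (hm : StrictMono m) :
    basePolytope (rankHat Δ D f ε V m) ⊆ achievableFakeUtilities Δ D f ε V m := by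
  have hq := (Fintype.equivFin E).injective
  refine (basePolytope_subset_convexHull_greedy
    (isPolymatroidRank_rankHat hf hε hm₀ hm).empty hq).trans (convexHull_min ?_ ?_)
  · rintro _ ⟨w, rfl⟩
    exact greedy_rankHat_mem_achievableFakeUtilities hf hε hm₀ hm (weightRank_injective w hq)
  · exact convex_achievableFakeUtilities Δ D f ε V fun k => (hm₀ k).le

end RankHat

end Persuasion

theorem mainTheorem6 {E : Type u} [Fintype E] [DecidableEq E]
    (f : Finset E → ℝ) (hf : Persuasion.IsPolymatroidRank f)
    (ε V : ℝ) (hε : 0 < ε) (K : ℕ) (hK : 0 < K) (hV : V = (1 + ε) ^ K)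
    (m : Fin K → ℝ) (hm_pos : ∀ k, 0 < m k) (hm_mono : StrictMono m)
    (D : E → Measure ℝ) [∀ i, IsProbabilityMeasure (D i)]
    (hD : ∀ i, ∀ᵐ t ∂(D i), t ∈ Set.Icc 1 V)
    (Δ : Fin K → Persuasion.MappingRule.{u, v} E) :
    -- for fixed posterior means: the maximum is attained, has a closed form, is a rank function
    (∀ (k : Fin K) (μ : E → ℝ), (∀ i, μ i ∈ Set.Icc 1 V) →
      (∀ S : Finset E,
        IsGreatest ((fun x : E → ℝ => ∑ i ∈ S, Persuasion.fakeUtility ε V m k μ x i) ''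
          Persuasion.receiverAllocations f ε V m μ) (Persuasion.gHat f ε V m k μ S) ∧
        Persuasion.gHat f ε V m k μ S =
          m k * (f (Persuasion.agentsAbove ε V μ k ∪ (S ∩ Persuasion.agentsIn ε V μ k))
            - f (Persuasion.agentsAbove ε V μ k))) ∧
      Persuasion.IsPolymatroidRank (Persuasion.gHat f ε V m k μ)) ∧
    -- all expectations involved exist
    (∀ k, ∀ᵐ σ ∂((Δ k).signalLaw D), ∀ i, (Δ k).posteriorMean D σ i ∈ Set.Icc 1 V) ∧
    (∀ (k : Fin K) (S : Finset E),
      Integrable (fun σ => Persuasion.gHat f ε V m k ((Δ k).posteriorMean D σ) S)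
        ((Δ k).signalLaw D)) ∧
    (∀ (k : Fin K) (x : (∀ i, (Δ k).Signal i) → E → ℝ),
      (Δ k).IsSelectionRule D f ε V m x → ∀ i,
        Integrable (fun σ =>
          Persuasion.fakeUtility ε V m k ((Δ k).posteriorMean D σ) (x σ) i)
          ((Δ k).signalLaw D)) ∧
    -- the polymatroid and the two inclusions
    Persuasion.IsPolymatroidRank (Persuasion.rankHat Δ D f ε V m) ∧
    Persuasion.achievableFakeUtilities Δ D f ε V m ⊆
      Persuasion.independencePolytope (Persuasion.rankHat Δ D f ε V m) ∧
    Persuasion.basePolytope (Persuasion.rankHat Δ D f ε V m) ⊆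
      Persuasion.achievableFakeUtilities Δ D f ε V m := by
  have hε₀ := hε.le
  refine ⟨fun k μ _ => ⟨fun S => ⟨?_, ?_⟩, ?_⟩, fun k => (Δ k).ae_posteriorMean_mem_Icc D hD,
    fun k S => (Δ k).integrable_gHat D hf V hε₀ hm_pos hm_mono k S,
    fun k x hx => hx.integrable_fakeUtility (hm_pos k).le, ?_, ?_, ?_⟩
  · exact Persuasion.isGreatest_gHat hf hε₀ hm_pos hm_mono k μ S
  · exact congrFun (Persuasion.gHat_eq hf hε₀ hm_pos hm_mono k μ) S
  · exact Persuasion.isPolymatroidRank_gHat hf hε₀ hm_pos hm_mono k μ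
  · exact Persuasion.isPolymatroidRank_rankHat hf hε₀ hm_pos hm_mono
  · exact Persuasion.achievableFakeUtilities_subset_independencePolytope hf hε₀ hm_pos hm_mono
  · exact Persuasion.basePolytope_subset_achievableFakeUtilities hf hε₀ hm_pos hm_mono
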